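/- Let $\Omega\subset\mathbb R^2$ be a nonempty, open, bounded, connected set, let $L>0$ be a real number, and let $\mathcal A(\Omega)$ be the class of open subsets of $\Omega$. A sequence $(A_n)_{n\in\mathbb N}$ in $\mathcal A(\Omega)$ is said to Hausdorff converge to $A\in\mathcal A(\Omega)$ if $\mathrm d_H(\overline\Omega\setminus A_n,\overline\Omega\setminus A)\to 0$, where $\mathrm d_H$ is the Hausdorff distance between closed sets induced by the Euclidean distance. Let $F\colon\mathcal A(\Omega)\to[0,+\infty]$ be a set function that is (i) lower semicontinuous with respect to the Hausdorff convergence of open sets: $F(A)\le\liminf_{n\to\infty}F(A_n)$ whenever $(A_n)$ Hausdorff converges to $A$ in $\mathcal A(\Omega)$; (ii) monotone with respect to set inclusion: $F(A_1)\le F(A_2)$ whenever $A_1,A_2\in\mathcal A(\Omega)$ and $A_1\subset A_2$. Then the problem $$\min\{F(\Omega\setminus\Sigma):\ \Sigma\subset\overline\Omega \text{ closed, connected, and } \mathcal H^1(\Sigma)=L\},$$ where $\mathcal H^1$ is the one-dimensional Hausdorff measure, has a minimizer; that is, there is a closed connected set $\Sigma\subset\overline\Omega$ with $\mathcal H^1(\Sigma)=L$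 such that $F(\Omega\setminus\Sigma)\le F(\Omega\setminus\Sigma')$ for every closed connected $\Sigma'\subset\overline\Omega$ with $\mathcal H^1(\Sigma')=L$. -/

import Mathlib

open MeasureTheory Filter Topology TopologicalSpace
open scoped ENNReal

/-- The Euclidean plane `ℝ²`, with its Euclidean distance. -/
abbrev Plane : Type := EuclideanSpace ℝ (Fin 2)

/-- The class `𝒜(Ω)` of the open subsets of `Ω`, ordered by inclusion. -/
abbrev OpenSubsets (Ω : Opens Plane) : Type := Set.Iic Ω

/-- The open set `Ω ∖ K`, for `K` closed, as a member of `𝒜(Ω)`. -/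
def removeClosed (Ω : Opens Plane) (K : Closeds Plane) : OpenSubsets Ω :=
  ⟨⟨(Ω : Set Plane) \ K, Ω.isOpen.sdiff K.isClosed⟩, Set.sdiff_subset⟩

/-- The relative complement `closure Ω ∖ A` of a member `A` of `𝒜(Ω)`. -/
def closureDiff (Ω : Opens Plane) (A : OpenSubsets Ω) : Set Plane :=
  closure (Ω : Set Plane) \ (A.1 : Set Plane)

/-- Hausdorff convergence of open sets in `𝒜(Ω)`: the Hausdorff distance between the closed sets
`closure Ω ∖ A n` and `closure Ω ∖ B` tends to `0`. -/
def HausdorffConverges (Ω : Opens Plane) (A : ℕ → OpenSubsets Ω) (B : OpenSubsets Ω) : Prop :=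
  Tendsto (fun n => Metric.hausdorffEDist (closureDiff Ω (A n)) (closureDiff Ω B)) atTop (𝓝 0)

/-- Lower semicontinuity of a set function with respect to Hausdorff convergence of open sets. -/
def HausdorffLowerSemicontinuous (Ω : Opens Plane) (F : OpenSubsets Ω → ℝ≥0∞) : Prop :=
  ∀ (A : ℕ → OpenSubsets Ω) (B : OpenSubsets Ω), HausdorffConverges Ω A B →
    F B ≤ liminf (fun n => F (A n)) atTop

/-- The admissible sets: closed connected subsets of `closure Ω` of one-dimensional Hausdorff
measure `L`. -/
def admissibleSets (Ω : Opens Plane) (L : ℝ) : Set (Closeds Plane) :=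
  {K | (K : Set Plane) ⊆ closure (Ω : Set Plane) ∧ IsConnected (K : Set Plane) ∧
    Measure.hausdorffMeasure 1 (K : Set Plane) = ENNReal.ofReal L}

/-!
The proof is the direct method. Compact subsets of the closure of `Ω` form a compact space for the
Hausdorff distance, so a minimizing sequence of admissible sets has a subsequence converging to some
compact set `S`. By Gołąb's theorem `S` is connected and has one-dimensional measure at most `L`, and
lower semicontinuity of `F` shows that removing `S` costs no more than the infimum. The measure of
`S` may be smaller than `L`. If `S` meets `Ω`, an arc of a rapidly oscillating Lipschitz curve in a
small ball is added; by continuity in the length of the arc the measure can be adjusted to be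
exactly `L`, and monotonicity of `F` shows that this does not increase the cost. If `S` lies in the
boundary of `Ω`, such an enlargement may be impossible, but then nothing was removed from `Ω`, so
that the infimum is the largest value of `F` and every admissible set is a minimizer.

Gołąb's theorem (`isConnected_and_hausdorffMeasure_le_of_tendsto`) is obtained without
rectifiability theory. Let connected sets `S n` of measure at most `L` converge to `T`, and let `p` be
a dense sequence in `T`. Cover `S n` by small open sets whose diameters have sum about `L`. Since
`S n` is connected, any two members of the cover are joined by a chain of members that meet
successively, and so points of `S n` close to the points `p j` can be joined by a tree of discrete
paths (`exists_chain_tree`): each new path follows a shortest chain to the members used before, no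
member is used twice, and hence the total length is about `L` at most. In the limit along an
ultrafilter these paths become Lipschitz curves in `T` which form a tree containing all the points
`p j`, of total length at most `L` (`exists_lipschitz_tree`).

Finally the closure of a countable tree of curves has measure at most its length
(`hausdorffMeasure_le_of_tree`). Apart from the first `k` curves, the tree consists of branches
attached to them, whose total length tends to `0` as `k` grows. Points in the closure of a branch lie
in a ball whose radius is the length of the branch, and limits of points from infinitely many
branches lie on the first `k` curves.
-/

/-! ### Chains in a connected set covered by small open sets -/

/-- Indices of the cover `U` that are joined to an index in `W` by a chain of `k` steps, where
consecutive members of the chain meet inside `S`. -/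
def chainReach {X ι : Type*} (S : Set X) (U : ι → Set X) (W : Set ι) : ℕ → Set ι
  | 0 => W
  | k + 1 => {v | ∃ u ∈ chainReach S U W k, (S ∩ (U u ∩ U v)).Nonempty}

/-- A discrete path `γ` in `S` that starts at `p`, has length `∑ i ∈ I, d i`, visits every `U i`
with `i ∈ I` and ends in some `U u` with `u ∈ W`, the indices in `I` being new with respect to `W`.
The map `γ` is a step function of the time: it is `1`-Lipschitz up to the error `δ`, exactly so
when one of the two times is `0`. -/
structure IsChainPath {X ι : Type*} [PseudoMetricSpace X] (S : Set X) (U : ι → Set X) (d : ι → ℝ)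
    (δ : ℝ) (W : Set ι) (p : X) (I : Finset ι) (γ : ℝ → X) : Prop where
  notMem : ∀ i ∈ I, i ∉ W
  start : γ 0 = p
  mem : ∀ s, γ s ∈ S
  dist_start : ∀ t, 0 ≤ t → dist p (γ t) ≤ t
  dist_le : ∀ s t, 0 ≤ s → s ≤ t → dist (γ s) (γ t) ≤ t - s + δ
  visits : ∀ i ∈ I, ∃ t ∈ Set.Icc 0 (∑ i ∈ I, d i), γ t ∈ U i
  finish : ∃ u ∈ W, γ (∑ i ∈ I, d i) ∈ U u

section Chains

variable {X ι : Type*} [PseudoMetricSpace X] {S : Set X} {U : ι → Set X} {d : ι → ℝ} {δ : ℝ}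

/-- Chains of minimal length use each index at most once, so the diameters of the sets they cross
add up without repetition. -/
theorem exists_isChainPath_of_mem_chainReach (hd0 : ∀ i, 0 < d i) (hdδ : ∀ i, d i ≤ δ)
    (hU : ∀ i, ∀ x ∈ U i, ∀ y ∈ U i, dist x y ≤ d i) (W : Set ι) (k : ℕ) :
    ∀ v ∈ chainReach S U W k, (∀ m < k, v ∉ chainReach S U W m) → ∀ p ∈ S, p ∈ U v →
      ∃ I γ, IsChainPath S U d δ W p I γ ∧ ∀ i ∈ I, ∃ m ≤ k, i ∈ chainReach S U W m := by
  classical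
  induction k with
  | zero =>
    intro v hv _ p hpS hpv
    have hδ : 0 ≤ δ := (hd0 v).le.trans (hdδ v)
    refine ⟨∅, fun _ => p, ⟨by simp, rfl, fun _ => hpS, ?_, ?_, by simp, v, hv, hpv⟩, by simp⟩
    · intro t ht; simpa using ht
    · intro s t _ hst; rw [dist_self]; linarith
  | succ k ih =>
    intro v hv hmin p hpS hpv
    obtain ⟨u, hu, x, hxS, hxu, hxv⟩ := hv
    have hδ : 0 ≤ δ := (hd0 v).le.trans (hdδ v)
    -- the predecessor `u` of `v` in a shortest chain has level exactly `k`
    obtain ⟨I, γ, hγ, hI⟩ := ih u hu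
      (fun m hm hum => hmin (m + 1) (by omega) ⟨u, hum, x, hxS, hxu, hxv⟩) x hxS hxu
    have hvI : v ∉ I := fun h => by
      obtain ⟨m, hm, hvm⟩ := hI v h
      exact hmin m (by omega) hvm
    have hnn : 0 ≤ ∑ i ∈ I, d i := Finset.sum_nonneg fun i _ => (hd0 i).le
    have ha := hd0 v
    have hpx : dist p x ≤ d v := hU v p hpv x hxv
    have hsum : ∑ i ∈ insert v I, d i = d v + ∑ i ∈ I, d i := Finset.sum_insert hvI
    -- stay at `p` during a time `d v`, which pays for the jump to `x`, then follow `γ`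
    set γ' : ℝ → X := fun t => if t < d v then p else γ (t - d v) with hγ'
    have h0 : ∀ t, t < d v → γ' t = p := fun t ht => if_pos ht
    have h1 : ∀ t, d v ≤ t → γ' t = γ (t - d v) := fun t ht => if_neg ht.not_gt
    have hstart : ∀ t, 0 ≤ t → dist p (γ' t) ≤ t := by
      intro t ht
      rcases lt_or_ge t (d v) with h | h
      · rw [h0 t h, dist_self]; exact ht
      · rw [h1 t h]
        have := hγ.dist_start (t - d v) (by linarith)
        linarith [dist_triangle p x (γ (t - d v))]
    refine ⟨insert v I, γ', ⟨?_, h0 0 ha, ?_, hstart, ?_, ?_, ?_⟩, ?_⟩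
    · intro i hi
      rcases Finset.mem_insert.1 hi with rfl | hi
      · exact hmin 0 (by omega)
      · exact hγ.notMem i hi
    · intro s
      simp only [hγ']
      split_ifs
      · exact hpS
      · exact hγ.mem _
    · intro s t hs hst
      rcases lt_or_ge s (d v) with h | h
      · rw [h0 s h]
        have h2 := hstart t (hs.trans hst)
        linarith [hdδ v]
      · rw [h1 s h, h1 t (h.trans hst)]
        have := hγ.dist_le (s - d v) (t - d v) (by linarith) (by linarith)
        linarith
    · intro i hi
      rw [hsum]
      rcases Finset.mem_insert.1 hi with rfl | hi
      · exact ⟨0, ⟨le_rfl, by linarith⟩, by rw [h0 0 ha]; exact hpv⟩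
      · obtain ⟨t, ht, htU⟩ := hγ.visits i hi
        refine ⟨t + d v, ⟨by linarith [ht.1], by linarith [ht.2]⟩, ?_⟩
        rw [h1 _ (by linarith [ht.1]), add_sub_cancel_right]
        exact htU
    · rw [hsum, h1 _ (by linarith), add_sub_cancel_left]
      exact hγ.finish
    · intro i hi
      rcases Finset.mem_insert.1 hi with rfl | hi
      · exact ⟨k + 1, le_rfl, ⟨u, hu, x, hxS, hxu, hxv⟩⟩
      · obtain ⟨m, hm, h⟩ := hI i hi
        exact ⟨m, by omega, h⟩

/-- In a connected set every point is joined by a discrete path to a given family of members of an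
open cover, as soon as this family meets the set. -/
theorem exists_isChainPath (hS : IsPreconnected S) (hUo : ∀ i, IsOpen (U i))
    (hSU : S ⊆ ⋃ i, U i) (hd0 : ∀ i, 0 < d i) (hdδ : ∀ i, d i ≤ δ)
    (hU : ∀ i, ∀ x ∈ U i, ∀ y ∈ U i, dist x y ≤ d i) {W : Set ι}
    (hW : ∃ u ∈ W, (S ∩ U u).Nonempty) {p : X} (hp : p ∈ S) :
    ∃ I γ, IsChainPath S U d δ W p I γ := by
  classical
  obtain ⟨v, hpv, k, hk⟩ : ∃ v, p ∈ U v ∧ ∃ k, v ∈ chainReach S U W k := by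
    by_contra! hcon
    obtain ⟨w, hpw⟩ := Set.mem_iUnion.1 (hSU hp)
    obtain ⟨u, huW, x, hxS, hxu⟩ := hW
    -- otherwise the members of the cover inside and outside the range of the chains disconnect `S`
    obtain ⟨y, hyS, hy1, hy2⟩ := hS (⋃ i ∈ {i | ∃ k, i ∈ chainReach S U W k}, U i)
      (⋃ i ∈ {i | ¬ ∃ k, i ∈ chainReach S U W k}, U i)
      (isOpen_biUnion fun i _ => hUo i) (isOpen_biUnion fun i _ => hUo i)
      (fun y hy => by
        obtain ⟨i, hi⟩ := Set.mem_iUnion.1 (hSU hy)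
        by_cases h : ∃ k, i ∈ chainReach S U W k
        · exact Or.inl (Set.mem_biUnion (x := i) h hi)
        · exact Or.inr (Set.mem_biUnion (x := i) h hi))
      ⟨x, hxS, Set.mem_biUnion (x := u) ⟨0, huW⟩ hxu⟩
      ⟨p, hp, Set.mem_biUnion (x := w) (fun ⟨k, hk⟩ => hcon w hpw k hk) hpw⟩
    obtain ⟨i, ⟨k, hi⟩, hyi⟩ := Set.mem_iUnion₂.1 hy1
    obtain ⟨j, hj, hyj⟩ := Set.mem_iUnion₂.1 hy2
    exact hj ⟨k + 1, i, hi, y, hyS, hyi, hyj⟩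
  have hex : ∃ k, v ∈ chainReach S U W k := ⟨k, hk⟩
  obtain ⟨I, γ, h, -⟩ := exists_isChainPath_of_mem_chainReach hd0 hdδ hU W (Nat.find hex) v
    (Nat.find_spec hex) (fun m hm => Nat.find_min hex hm) p hp hpv
  exact ⟨I, γ, h⟩

/-- A sequence of points of a connected set is joined by a tree of discrete paths, the `j`-th of
which starts at the `j`-th point and ends near an earlier path. Distinct paths cross distinct
members of the cover, so the total length is bounded by the total size of the cover. -/
theorem exists_chain_tree (hS : IsPreconnected S) (hUo : ∀ i, IsOpen (U i))
    (hSU : S ⊆ ⋃ i, U i) (hd0 : ∀ i, 0 < d i) (hdδ : ∀ i, d i ≤ δ)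
    (hU : ∀ i, ∀ x ∈ U i, ∀ y ∈ U i, dist x y ≤ d i) {M : ℝ}
    (hM : ∀ I : Finset ι, ∑ i ∈ I, d i ≤ M) {p : ℕ → X} (hp : ∀ j, p j ∈ S) :
    ∃ (ℓ : ℕ → ℝ) (γ : ℕ → ℝ → X), (∀ j, 0 ≤ ℓ j) ∧ (∀ k, ∑ j ∈ Finset.range k, ℓ j ≤ M) ∧
      (∀ j, γ j 0 = p j) ∧ (∀ j s, γ j s ∈ S) ∧
      (∀ j s t, 0 ≤ s → s ≤ t → dist (γ j s) (γ j t) ≤ t - s + δ) ∧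
      ∀ j, 0 < j → ∃ i < j, ∃ t ∈ Set.Icc 0 (ℓ i), dist (γ j (ℓ j)) (γ i t) ≤ δ := by
  classical
  obtain ⟨u₀, hu₀⟩ := Set.mem_iUnion.1 (hSU (hp 0))
  have key : ∀ (W : Finset ι) (j : ℕ), ∃ (I : Finset ι) (γ : ℝ → X), u₀ ∈ W →
      IsChainPath S U d δ W (p j) I γ := by
    intro W j
    by_cases h : u₀ ∈ W
    · obtain ⟨I, γ, h'⟩ := exists_isChainPath hS hUo hSU hd0 hdδ hU (W := (W : Set ι))
        ⟨u₀, h, p 0, hp 0, hu₀⟩ (hp j)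
      exact ⟨I, γ, fun _ => h'⟩
    · exact ⟨∅, fun _ => p 0, fun h' => absurd h' h⟩
  choose I γ hγ using key
  -- `W j` collects the indices used by the paths before the `j`-th one
  obtain ⟨W, hW0, hWs⟩ : ∃ W : ℕ → Finset ι, W 0 = {u₀} ∧ ∀ j, W (j + 1) = W j ∪ I (W j) j :=
    ⟨fun n => Nat.rec {u₀} (fun j V => V ∪ I V j) n, rfl, fun j => rfl⟩
  have hu₀W : ∀ j : ℕ, u₀ ∈ W j := by
    intro j
    induction j with
    | zero => rw [hW0]; exact Finset.mem_singleton_self _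
    | succ j ih => rw [hWs]; exact Finset.mem_union_left _ ih
  have hc : ∀ j : ℕ, IsChainPath S U d δ (W j : Set ι) (p j) (I (W j) j) (γ (W j) j) :=
    fun j => hγ (W j) j (hu₀W j)
  have hvis : ∀ j, ∀ u ∈ W j, 0 < j →
      ∃ i < j, ∃ t ∈ Set.Icc 0 (∑ v ∈ I (W i) i, d v), γ (W i) i t ∈ U u := by
    intro j
    induction j with
    | zero => intro u _ h; exact absurd h (lt_irrefl 0)
    | succ j ih =>
      intro u hu _
      rw [hWs, Finset.mem_union] at hu
      rcases hu with hu | hu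
      · rcases Nat.eq_zero_or_pos j with rfl | hj
        · rw [hW0] at hu
          obtain rfl : u = u₀ := Finset.mem_singleton.1 hu
          refine ⟨0, Nat.one_pos, 0, ⟨le_rfl, Finset.sum_nonneg fun i _ => (hd0 i).le⟩, ?_⟩
          rw [(hc 0).start]
          exact hu₀
        · obtain ⟨i, hi, t, ht, h⟩ := ih u hu hj
          exact ⟨i, by omega, t, ht, h⟩
      · obtain ⟨t, ht, h⟩ := (hc j).visits u hu
        exact ⟨j, by omega, t, ht, h⟩
  refine ⟨fun j => ∑ v ∈ I (W j) j, d v, fun j => γ (W j) j,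
    fun j => Finset.sum_nonneg fun i _ => (hd0 i).le, fun k => ?_, fun j => (hc j).start,
    fun j => (hc j).mem, fun j => (hc j).dist_le, fun j hj => ?_⟩
  · refine le_trans ?_ (hM (W k))
    induction k with
    | zero => exact Finset.sum_nonneg fun i _ => (hd0 i).le
    | succ k ih =>
      rw [Finset.sum_range_succ, hWs, Finset.sum_union]
      · linarith
      · rw [Finset.disjoint_left]
        exact fun i hi hi' => (hc k).notMem i hi' hi
  · obtain ⟨u, hu, hend⟩ := (hc j).finish
    obtain ⟨i, hi, t, ht, h⟩ := hvis j u hu hj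
    exact ⟨i, hi, t, ht, (hU u _ hend _ h).trans (hdδ u)⟩

end Chains

/-! ### Lipschitz limits of trees of discrete paths -/

/-- A set of finite one-dimensional Hausdorff measure has open covers by small sets whose
diameters have almost optimal sum. -/
theorem exists_open_cover_of_hausdorffMeasure_le {X : Type*} [MetricSpace X] [MeasurableSpace X]
    [BorelSpace X] {S : Set X} {L : ℝ} (hL : 0 ≤ L) (hS : μH[1] S ≤ ENNReal.ofReal L) {ε : ℝ}
    (hε : 0 < ε) :
    ∃ (U : ℕ → Set X) (d : ℕ → ℝ), (∀ i, IsOpen (U i)) ∧ S ⊆ ⋃ i, U i ∧ (∀ i, 0 < d i) ∧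
      (∀ i, d i ≤ ε) ∧ (∀ i, ∀ x ∈ U i, ∀ y ∈ U i, dist x y ≤ d i) ∧
      ∀ I : Finset ℕ, ∑ i ∈ I, d i ≤ L + ε := by
  have hε2 : 0 < ε / 2 := by positivity
  have hlt : (⨅ (t : ℕ → Set X) (_ : S ⊆ ⋃ n, t n)
      (_ : ∀ n, Metric.ediam (t n) ≤ ENNReal.ofReal (ε / 2)),
      ∑' n, ⨆ _ : (t n).Nonempty, Metric.ediam (t n) ^ (1 : ℝ)) < ENNReal.ofReal (L + ε / 2) := by
    refine lt_of_le_of_lt ?_ ((ENNReal.ofReal_lt_ofReal_iff (by linarith)).2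
      (show L < L + ε / 2 by linarith))
    refine le_trans ?_ hS
    rw [Measure.hausdorffMeasure_apply]
    exact le_iSup₂ (f := fun (r : ℝ≥0∞) (_ : 0 < r) => ⨅ (t : ℕ → Set X) (_ : S ⊆ ⋃ n, t n)
      (_ : ∀ n, Metric.ediam (t n) ≤ r), ∑' n, ⨆ _ : (t n).Nonempty, Metric.ediam (t n) ^ (1 : ℝ))
      (ENNReal.ofReal (ε / 2)) (ENNReal.ofReal_pos.2 hε2)
  simp only [iInf_lt_iff] at hlt
  obtain ⟨t, hSt, htd, hsum⟩ := hlt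
  have hfin : ∀ n, Metric.ediam (t n) ≠ ∞ := fun n =>
    ((htd n).trans_lt ENNReal.ofReal_lt_top).ne
  have hterm : ∀ n, (⨆ _ : (t n).Nonempty, Metric.ediam (t n) ^ (1 : ℝ)) = Metric.ediam (t n) := by
    intro n
    rcases (t n).eq_empty_or_nonempty with h | h
    · simp [h]
    · simp [h]
  simp only [hterm] at hsum
  -- the enlargements `η i` have sum at most `ε / 4`
  obtain ⟨η, hη0, c, hη, hc⟩ := posSumOfEncodable (show 0 < ε / 4 by positivity) ℕ
  have hηle : ∀ I : Finset ℕ, ∑ i ∈ I, η i ≤ ε / 4 := fun I =>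
    (sum_le_hasSum I (fun i _ => (hη0 i).le) hη).trans hc
  have hdle : ∀ I : Finset ℕ, ∑ i ∈ I, (Metric.ediam (t i)).toReal ≤ L + ε / 2 := by
    intro I
    rw [← ENNReal.toReal_sum fun i _ => hfin i]
    refine ENNReal.toReal_le_of_le_ofReal (by linarith) ?_
    exact (ENNReal.sum_le_tsum I).trans hsum.le
  refine ⟨fun i => Metric.thickening (η i) (t i), fun i => (Metric.ediam (t i)).toReal + 2 * η i,
    fun i => Metric.isOpen_thickening, hSt.trans (Set.iUnion_mono fun i =>
    Metric.self_subset_thickening (hη0 i) _), fun i => ?_, fun i => ?_, fun i x hx y hy => ?_,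
    fun I => ?_⟩
  · have := hη0 i
    positivity
  · have h1 := ENNReal.toReal_le_of_le_ofReal hε2.le (htd i)
    have h2 := hηle {i}
    rw [Finset.sum_singleton] at h2
    linarith
  · obtain ⟨x', hx', hxx'⟩ := Metric.mem_thickening_iff.1 hx
    obtain ⟨y', hy', hyy'⟩ := Metric.mem_thickening_iff.1 hy
    have h1 : dist x' y' ≤ (Metric.ediam (t i)).toReal := by
      rw [dist_edist]
      exact ENNReal.toReal_mono (hfin i) (Metric.edist_le_ediam_of_mem hx' hy')
    have h2 := dist_triangle4 x x' y' y
    rw [dist_comm y' y] at h2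
    linarith
  · rw [Finset.sum_add_distrib, ← Finset.mul_sum]
    linarith [hdle I, hηle I]

theorem exists_tendsto_ultrafilter_of_hausdorffEDist {X : Type*} [PseudoEMetricSpace X]
    {S : ℕ → Set X} {T C : Set X} (hC : IsCompact C) (hSC : ∀ n, S n ⊆ C) (hT : IsClosed T)
    (𝒰 : Ultrafilter ℕ) (hTS : Tendsto (fun n => Metric.hausdorffEDist (S n) T) 𝒰 (𝓝 0))
    {f : ℕ → X} (hf : ∀ n, f n ∈ S n) : ∃ x ∈ T, Tendsto f 𝒰 (𝓝 x) := by
  obtain ⟨x, -, hx⟩ := hC.ultrafilter_le_nhds (𝒰.map f)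
    (tendsto_principal.2 (Eventually.of_forall fun n => hSC n (hf n)))
  have hx' : Tendsto f 𝒰 (𝓝 x) := hx
  refine ⟨x, ?_, hx'⟩
  rw [Metric.mem_iff_infEDist_zero_of_closed hT]
  have h1 : Tendsto (fun n => Metric.infEDist (f n) T) 𝒰 (𝓝 (Metric.infEDist x T)) :=
    (Metric.continuous_infEDist.tendsto x).comp hx'
  exact le_antisymm (le_of_tendsto_of_tendsto' h1 hTS fun n =>
    Metric.infEDist_le_hausdorffEDist_of_mem (hf n)) (zero_le)

/-- Discrete paths in connected sets `S n` of one-dimensional measure at most `L` that converge to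
a closed set `T` have Lipschitz limits in `T`. The limits form a tree of total length at most `L`
that joins a prescribed sequence of points of `T`. -/
theorem exists_lipschitz_tree {X : Type*} [MetricSpace X] [MeasurableSpace X] [BorelSpace X]
    {S : ℕ → Set X} {T C : Set X} {L : ℝ} (hL : 0 ≤ L) (hS : ∀ n, IsConnected (S n))
    (hSL : ∀ n, μH[1] (S n) ≤ ENNReal.ofReal L) (hC : IsCompact C) (hSC : ∀ n, S n ⊆ C)
    (hT : IsClosed T) (hTC : T ⊆ C)
    (hTS : Tendsto (fun n => Metric.hausdorffEDist (S n) T) atTop (𝓝 0))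
    {p : ℕ → X} (hp : ∀ j, p j ∈ T) :
    ∃ (ℓ : ℕ → ℝ) (γ : ℕ → ℝ → X), (∀ j, 0 ≤ ℓ j) ∧ (∀ k, ∑ j ∈ Finset.range k, ℓ j ≤ L) ∧
      (∀ j, γ j 0 = p j) ∧ (∀ j s, γ j s ∈ T) ∧
      (∀ j s t, 0 ≤ s → s ≤ t → dist (γ j s) (γ j t) ≤ t - s) ∧
      ∀ j, 0 < j → ∃ i < j, ∃ t ∈ Set.Icc 0 (ℓ i), γ j (ℓ j) = γ i t := by
  have hδ0 : ∀ n : ℕ, (0 : ℝ) < 1 / (n + 1) := fun n => by positivity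
  have hδ1 : ∀ n : ℕ, (1 : ℝ) / (n + 1) ≤ 1 := fun n => by
    rw [div_le_one (by positivity)]
    linarith [(Nat.cast_nonneg n : (0 : ℝ) ≤ n)]
  have hfin : ∀ n, Metric.hausdorffEDist (S n) T ≠ ∞ := fun n =>
    Metric.hausdorffEDist_ne_top_of_nonempty_of_bounded (hS n).nonempty ⟨p 0, hp 0⟩
      (hC.isBounded.subset (hSC n)) (hC.isBounded.subset hTC)
  have hq : ∀ n j, ∃ q ∈ S n,
      edist (p j) q < Metric.hausdorffEDist (S n) T + ENNReal.ofReal (1 / ((n : ℝ) + 1)) := by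
    intro n j
    refine Metric.exists_edist_lt_of_hausdorffEDist_lt (hp j) ?_
    rw [Metric.hausdorffEDist_comm]
    exact ENNReal.lt_add_right (hfin n) (ENNReal.ofReal_pos.2 (hδ0 n)).ne'
  choose q hqS hpq using hq
  have htree : ∀ n : ℕ, ∃ (ℓ : ℕ → ℝ) (γ : ℕ → ℝ → X), (∀ j, 0 ≤ ℓ j) ∧
      (∀ k, ∑ j ∈ Finset.range k, ℓ j ≤ L + 1 / ((n : ℝ) + 1)) ∧
      (∀ j, γ j 0 = q n j) ∧ (∀ j s, γ j s ∈ S n) ∧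
      (∀ j s t, 0 ≤ s → s ≤ t → dist (γ j s) (γ j t) ≤ t - s + 1 / ((n : ℝ) + 1)) ∧
      ∀ j, 0 < j → ∃ i < j, ∃ t ∈ Set.Icc 0 (ℓ i),
        dist (γ j (ℓ j)) (γ i t) ≤ 1 / ((n : ℝ) + 1) := by
    intro n
    obtain ⟨U, d, hUo, hSU, hd0, hdδ, hU, hM⟩ :=
      exists_open_cover_of_hausdorffMeasure_le hL (hSL n) (hδ0 n)
    exact exists_chain_tree (hS n).isPreconnected hUo hSU hd0 hdδ hU hM (hqS n)
  choose ℓ γ hℓ0 hℓL hγ0 hγS hγd hγe using htree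
  -- limits along an ultrafilter exist simultaneously for all times and all paths
  let 𝒰 : Ultrafilter ℕ := hyperfilter ℕ
  have h𝒰 : (𝒰 : Filter ℕ) ≤ atTop := Nat.hyperfilter_le_atTop
  have hδ : Tendsto (fun n : ℕ => (1 : ℝ) / (n + 1)) 𝒰 (𝓝 0) :=
    tendsto_one_div_add_atTop_nhds_zero_nat.mono_left h𝒰
  have hTS' := hTS.mono_left h𝒰
  have hlim : ∀ j s, ∃ x ∈ T, Tendsto (fun n => γ n j s) 𝒰 (𝓝 x) := fun j s =>
    exists_tendsto_ultrafilter_of_hausdorffEDist hC hSC hT 𝒰 hTS' fun n => hγS n j s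
  choose g hgT hg using hlim
  have hℓle : ∀ n j, ℓ n j ≤ L + 1 := by
    intro n j
    have h1 := hℓL n (j + 1)
    rw [Finset.sum_range_succ] at h1
    have h2 : 0 ≤ ∑ i ∈ Finset.range j, ℓ n i := Finset.sum_nonneg fun i _ => hℓ0 n i
    linarith [hδ1 n]
  have hreal : ∀ f : ℕ → ℝ, (∀ n, f n ∈ Set.Icc 0 (L + 1)) → ∃ x, Tendsto f 𝒰 (𝓝 x) := by
    intro f hf
    obtain ⟨x, -, hx⟩ := (isCompact_Icc (a := (0 : ℝ)) (b := L + 1)).ultrafilter_le_nhds (𝒰.map f)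
      (tendsto_principal.2 (Eventually.of_forall hf))
    exact ⟨x, hx⟩
  have hlimℓ : ∀ j, ∃ x, Tendsto (fun n => ℓ n j) 𝒰 (𝓝 x) := fun j =>
    hreal _ fun n => ⟨hℓ0 n j, hℓle n j⟩
  choose lam hlam using hlimℓ
  have hlam0 : ∀ j, 0 ≤ lam j := fun j => ge_of_tendsto' (hlam j) fun n => hℓ0 n j
  have habs : ∀ n j s t, 0 ≤ s → 0 ≤ t →
      dist (γ n j s) (γ n j t) ≤ |s - t| + 1 / ((n : ℝ) + 1) := by
    intro n j s t hs ht
    rcases le_total s t with h | h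
    · rw [abs_sub_comm, abs_of_nonneg (sub_nonneg.2 h)]
      exact hγd n j s t hs h
    · rw [abs_of_nonneg (sub_nonneg.2 h), dist_comm]
      exact hγd n j t s ht h
  refine ⟨lam, g, hlam0, fun k => ?_, fun j => ?_, hgT, fun j s t hs hst => ?_, fun j hj => ?_⟩
  · have h1 : Tendsto (fun n => ∑ j ∈ Finset.range k, ℓ n j) 𝒰
        (𝓝 (∑ j ∈ Finset.range k, lam j)) := tendsto_finsetSum _ fun j _ => hlam j
    have h2 : Tendsto (fun n : ℕ => L + (1 : ℝ) / (n + 1)) 𝒰 (𝓝 (L + 0)) := hδ.const_add L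
    rw [add_zero] at h2
    exact le_of_tendsto_of_tendsto' h1 h2 fun n => hℓL n k
  · refine tendsto_nhds_unique (hg j 0) ?_
    simp only [hγ0]
    rw [tendsto_iff_edist_tendsto_0]
    have h1 : Tendsto (fun n : ℕ => Metric.hausdorffEDist (S n) T +
        ENNReal.ofReal (1 / ((n : ℝ) + 1))) 𝒰 (𝓝 (0 + ENNReal.ofReal 0)) :=
      hTS'.add (ENNReal.tendsto_ofReal hδ)
    rw [ENNReal.ofReal_zero, add_zero] at h1
    refine tendsto_of_tendsto_of_tendsto_of_le_of_le tendsto_const_nhds h1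
      (fun n => zero_le) fun n => ?_
    rw [edist_comm]
    exact (hpq n j).le
  · have h1 := (hg j s).dist (hg j t)
    have h2 : Tendsto (fun n : ℕ => t - s + (1 : ℝ) / (n + 1)) 𝒰 (𝓝 (t - s + 0)) :=
      hδ.const_add _
    rw [add_zero] at h2
    exact le_of_tendsto_of_tendsto' h1 h2 fun n => hγd n j s t hs hst
  · choose i hij t ht hdist using fun n => hγe n j hj
    obtain ⟨i₀, hi₀, hi⟩ : ∃ i₀ < j, Tendsto i 𝒰 (𝓝 i₀) :=
      (Set.finite_Iio j).isCompact.ultrafilter_le_nhds (𝒰.map i)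
        (tendsto_principal.2 (Eventually.of_forall hij))
    have hi' : ∀ᶠ n in (𝒰 : Filter ℕ), i n = i₀ := by
      rw [nhds_discrete, tendsto_pure] at hi
      exact hi
    obtain ⟨t₀, ht₀⟩ := hreal t fun n => ⟨(ht n).1, (ht n).2.trans (hℓle n _)⟩
    have ht₀0 : 0 ≤ t₀ := ge_of_tendsto' ht₀ fun n => (ht n).1
    have ht₀ℓ : t₀ ≤ lam i₀ := le_of_tendsto_of_tendsto ht₀ (hlam i₀) <| by
      filter_upwards [hi'] with n hn
      rw [← hn]
      exact (ht n).2
    refine ⟨i₀, hi₀, t₀, ⟨ht₀0, ht₀ℓ⟩, ?_⟩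
    rw [← dist_le_zero]
    have h1 := (hg j (lam j)).dist (hg i₀ t₀)
    have h2 : Tendsto (fun n : ℕ => |lam j - ℓ n j| + |t n - t₀| + 3 * ((1 : ℝ) / (n + 1))) 𝒰
        (𝓝 (|lam j - lam j| + |t₀ - t₀| + 3 * 0)) :=
      (((hlam j).const_sub _).abs.add (ht₀.sub_const _).abs).add (hδ.const_mul 3)
    simp only [sub_self, abs_zero, mul_zero, add_zero] at h2
    refine le_of_tendsto_of_tendsto h1 h2 ?_
    filter_upwards [hi'] with n hn
    have h3 := habs n j (lam j) (ℓ n j) (hlam0 j) (hℓ0 n j)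
    have h4 := habs n i₀ (t n) t₀ (ht n).1 ht₀0
    have h5 := hdist n
    rw [hn] at h5
    have h6 := dist_triangle4 (γ n j (lam j)) (γ n j (ℓ n j)) (γ n i₀ (t n)) (γ n i₀ t₀)
    linarith

/-! ### Measure of the closure of a countable tree of curves -/

/-- The first index `≥ k` in the ancestral line `…, par (par j), par j, j` of `j`, when the indices
decrease along this line. -/
def branchRoot (par : ℕ → ℕ) (k : ℕ) (j : ℕ) : ℕ :=
  if _h : par j < j ∧ k ≤ par j then branchRoot par k (par j) else j
termination_by j
decreasing_by exact _h.1

theorem branchRoot_of_le {par : ℕ → ℕ} {k j : ℕ} (h : par j < j) (hk : k ≤ par j) :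
    branchRoot par k j = branchRoot par k (par j) := by
  rw [branchRoot, dif_pos ⟨h, hk⟩]

theorem branchRoot_of_lt {par : ℕ → ℕ} {k j : ℕ} (hk : par j < k) : branchRoot par k j = j := by
  rw [branchRoot, dif_neg fun h => by omega]

section Tree

variable {X : Type*} [MetricSpace X] {ℓ : ℕ → ℝ} {γ : ℕ → ℝ → X}

theorem lipschitzOnWith_and_isCompact_image_Icc {g : ℝ → X} {a : ℝ}
    (hg : ∀ s t, 0 ≤ s → s ≤ t → dist (g s) (g t) ≤ t - s) :
    LipschitzOnWith 1 g (Set.Icc 0 a) ∧ IsCompact (g '' Set.Icc 0 a) := by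
  have h : LipschitzOnWith 1 g (Set.Icc 0 a) := by
    refine LipschitzOnWith.of_dist_le_mul fun s hs t ht => ?_
    rw [NNReal.coe_one, one_mul, Real.dist_eq]
    rcases le_total s t with hst | hst
    · rw [abs_sub_comm, abs_of_nonneg (sub_nonneg.2 hst)]
      exact hg s t hs.1 hst
    · rw [abs_of_nonneg (sub_nonneg.2 hst), dist_comm]
      exact hg t s ht.1 hst
  exact ⟨h, isCompact_Icc.image_of_continuousOn h.continuousOn⟩

/-- A curve of index `≥ k` stays within the total length of its branch from the point where this
branch is attached to the first `k` curves. -/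
theorem edist_branchRoot_le
    (hγ : ∀ j s t, 0 ≤ s → s ≤ t → dist (γ j s) (γ j t) ≤ t - s) {par : ℕ → ℕ}
    (hpar : ∀ j, 0 < j → par j < j)
    (hatt : ∀ j, 0 < j → ∃ t ∈ Set.Icc 0 (ℓ (par j)), γ j (ℓ j) = γ (par j) t) {k : ℕ} (hk : 0 < k)
    (m : ℕ) : γ (branchRoot par k (m + k)) (ℓ (branchRoot par k (m + k))) ∈
        ⋃ j ∈ Finset.range k, γ j '' Set.Icc 0 (ℓ j) ∧
      ∀ s ∈ Set.Icc 0 (ℓ (m + k)), edist (γ (m + k) s)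
        (γ (branchRoot par k (m + k)) (ℓ (branchRoot par k (m + k)))) ≤
        ∑ i ∈ Finset.range (m + 1),
          if branchRoot par k (i + k) = branchRoot par k (m + k) then ENNReal.ofReal (ℓ (i + k))
          else 0 := by
  induction m using Nat.strong_induction_on with
  | _ m ih =>
    have hself : ∀ s ∈ Set.Icc 0 (ℓ (m + k)), edist (γ (m + k) s) (γ (m + k) (ℓ (m + k))) ≤
        ENNReal.ofReal (ℓ (m + k)) := by
      intro s hs
      rw [edist_dist]
      exact ENNReal.ofReal_le_ofReal ((hγ _ s _ hs.1 hs.2).trans (by linarith [hs.1]))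
    obtain ⟨t, ht, hend⟩ := hatt (m + k) (by omega)
    have hp := hpar (m + k) (by omega)
    rcases lt_or_ge (par (m + k)) k with h | h
    · have hr : branchRoot par k (m + k) = m + k := branchRoot_of_lt h
      constructor
      · rw [hr, hend]
        exact Set.mem_biUnion (x := par (m + k)) (Finset.mem_coe.2 (Finset.mem_range.2 h))
          ⟨t, ht, rfl⟩
      · intro s hs
        rw [Finset.sum_range_succ, if_pos rfl]
        refine le_trans ?_ le_add_self
        rw [hr]
        exact hself s hs
    · obtain ⟨m', hm'⟩ : ∃ m', par (m + k) = m' + k := ⟨par (m + k) - k, by omega⟩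
      have hr : branchRoot par k (m + k) = branchRoot par k (m' + k) := by
        rw [branchRoot_of_le hp h, hm']
      rw [hm'] at ht hend
      obtain ⟨ih1, ih2⟩ := ih m' (by omega)
      refine ⟨by rw [hr]; exact ih1, fun s hs => ?_⟩
      rw [Finset.sum_range_succ, if_pos rfl, hr]
      refine (edist_triangle _ (γ (m + k) (ℓ (m + k))) _).trans ?_
      rw [add_comm]
      refine add_le_add ?_ (hself s hs)
      rw [hend]
      refine (ih2 t ht).trans (Finset.sum_le_sum_of_subset ?_)
      exact Finset.range_mono (by omega)

/-- The closure of a countable tree of curves is covered by the first `k` curves and by balls that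
contain the branches attached to them. Limit points of infinitely many distinct branches need no
ball of their own: the sizes of the branches tend to `0`, so such points lie on the first `k`
curves. -/
theorem subset_iUnion_branch (hℓ : ∀ j, 0 ≤ ℓ j) (hsum : ∑' j, ENNReal.ofReal (ℓ j) ≠ ∞)
    (hγ : ∀ j s t, 0 ≤ s → s ≤ t → dist (γ j s) (γ j t) ≤ t - s)
    (hatt : ∀ j, 0 < j → ∃ i < j, ∃ t ∈ Set.Icc 0 (ℓ i), γ j (ℓ j) = γ i t) {T : Set X}
    (hT : T ⊆ closure (Set.range fun j => γ j 0)) {k : ℕ} (hk : 0 < k) :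
    ∃ (e : ℕ → X) (w : ℕ → ℝ≥0∞), ∑' r, w r = ∑' i, ENNReal.ofReal (ℓ (i + k)) ∧
      T ⊆ (⋃ j ∈ Finset.range k, γ j '' Set.Icc 0 (ℓ j)) ∪
        ⋃ r, Metric.closedEBall (e r) (w r) := by
  have hatt' : ∀ j, ∃ i, 0 < j → i < j ∧ ∃ t ∈ Set.Icc 0 (ℓ i), γ j (ℓ j) = γ i t := by
    intro j
    by_cases hj : 0 < j
    · obtain ⟨i, hi, h⟩ := hatt j hj
      exact ⟨i, fun _ => ⟨hi, h⟩⟩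
    · exact ⟨0, fun h => absurd h hj⟩
  choose par hpar using hatt'
  set A : Set X := ⋃ j ∈ Finset.range k, γ j '' Set.Icc 0 (ℓ j) with hA
  let e : ℕ → X := fun r => γ r (ℓ r)
  let w : ℕ → ℝ≥0∞ := fun r =>
    ∑' i, if branchRoot par k (i + k) = r then ENNReal.ofReal (ℓ (i + k)) else 0
  have hw : ∑' r, w r = ∑' i, ENNReal.ofReal (ℓ (i + k)) := by
    rw [ENNReal.tsum_comm]
    simp only [tsum_ite_eq']
  have hwtop : ∑' r, w r ≠ ∞ := by
    rw [hw]
    refine ne_top_of_le_ne_top hsum ?_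
    exact ENNReal.tsum_comp_le_tsum_of_injective (add_left_injective k) _
  have hAc : IsCompact A := (Finset.range k).isCompact_biUnion fun j _ =>
    (lipschitzOnWith_and_isCompact_image_Icc (hγ j)).2
  have hbranch : ∀ m, e (branchRoot par k (m + k)) ∈ A ∧
      edist (γ (m + k) 0) (e (branchRoot par k (m + k))) ≤ w (branchRoot par k (m + k)) := by
    intro m
    obtain ⟨h1, h2⟩ := edist_branchRoot_le hγ (fun j hj => (hpar j hj).1)
      (fun j hj => (hpar j hj).2) hk m
    exact ⟨h1, (h2 0 ⟨le_rfl, hℓ _⟩).trans (ENNReal.sum_le_tsum _)⟩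
  refine ⟨e, w, hw, fun x hx => ?_⟩
  by_contra hcon
  rw [Set.mem_union, not_or] at hcon
  obtain ⟨hxA, hxB⟩ := hcon
  have hη : Metric.infEDist x A ≠ 0 := fun h =>
    hxA ((Metric.mem_iff_infEDist_zero_of_closed hAc.isClosed).2 h)
  obtain ⟨η, hη0, hηx⟩ := ENNReal.lt_iff_exists_nnreal_btwn.1 (pos_iff_ne_zero.2 hη)
  have hη2 : (η : ℝ≥0∞) / 2 ≠ 0 := (ENNReal.half_pos hη0.ne').ne'
  -- only finitely many branches are large, so `x` has a neighbourhood that misses them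
  have hfin : {r | (η : ℝ≥0∞) / 2 ≤ w r}.Finite :=
    ENNReal.finite_const_le_of_tsum_ne_top hwtop hη2
  have hB : IsClosed (A ∪ ⋃ r ∈ {r | (η : ℝ≥0∞) / 2 ≤ w r}, Metric.closedEBall (e r) (w r)) :=
    hAc.isClosed.union (hfin.isClosed_biUnion fun r _ => Metric.isClosed_closedEBall)
  have hxn : x ∉ A ∪ ⋃ r ∈ {r | (η : ℝ≥0∞) / 2 ≤ w r}, Metric.closedEBall (e r) (w r) := by
    rintro (h | h)
    · exact hxA h
    · obtain ⟨r, -, hr⟩ := Set.mem_iUnion₂.1 h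
      exact hxB (Set.mem_iUnion.2 ⟨r, hr⟩)
  obtain ⟨y, ⟨hyn, hyη⟩, j, rfl⟩ := mem_closure_iff.1 (hT hx) _
    (hB.isOpen_compl.inter (Metric.isOpen_eball (x := x) (ε := (η : ℝ≥0∞) / 2)))
    ⟨hxn, Metric.mem_eball_self (pos_iff_ne_zero.2 hη2)⟩
  rcases lt_or_ge j k with hj | hj
  · exact hyn (Or.inl (Set.mem_biUnion (x := j) (Finset.mem_coe.2 (Finset.mem_range.2 hj))
      ⟨0, ⟨le_rfl, hℓ j⟩, rfl⟩))
  · obtain ⟨m, rfl⟩ : ∃ m, j = m + k := ⟨j - k, by omega⟩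
    obtain ⟨h1, h2⟩ := hbranch m
    rcases le_or_gt ((η : ℝ≥0∞) / 2) (w (branchRoot par k (m + k))) with h | h
    · exact hyn (Or.inr (Set.mem_biUnion (x := branchRoot par k (m + k)) h h2))
    · refine hηx.not_ge ?_
      calc Metric.infEDist x A ≤ edist x (e (branchRoot par k (m + k))) :=
            Metric.infEDist_le_edist_of_mem h1
        _ ≤ edist x (γ (m + k) 0) + edist (γ (m + k) 0) (e (branchRoot par k (m + k))) :=
            edist_triangle _ _ _
        _ ≤ (η : ℝ≥0∞) / 2 + (η : ℝ≥0∞) / 2 := by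
            refine add_le_add ?_ (h2.trans h.le)
            rw [edist_comm]
            exact (Metric.mem_eball.1 hyη).le
        _ = η := ENNReal.add_halves _

/-- The closure of the starting points of a countable tree of curves has measure at most the total
length of the tree. -/
theorem hausdorffMeasure_le_of_tree [MeasurableSpace X] [BorelSpace X] {L : ℝ}
    (hℓ : ∀ j, 0 ≤ ℓ j) (hL : ∀ k, ∑ j ∈ Finset.range k, ℓ j ≤ L)
    (hγ : ∀ j s t, 0 ≤ s → s ≤ t → dist (γ j s) (γ j t) ≤ t - s)
    (hatt : ∀ j, 0 < j → ∃ i < j, ∃ t ∈ Set.Icc 0 (ℓ i), γ j (ℓ j) = γ i t) {T : Set X}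
    (hT : T ⊆ closure (Set.range fun j => γ j 0)) : μH[1] T ≤ ENNReal.ofReal L := by
  have hpart : ∀ k, ∑ j ∈ Finset.range k, ENNReal.ofReal (ℓ j) ≤ ENNReal.ofReal L := fun k => by
    rw [← ENNReal.ofReal_sum_of_nonneg fun j _ => hℓ j]
    exact ENNReal.ofReal_le_ofReal (hL k)
  have hsum : ∑' j, ENNReal.ofReal (ℓ j) ≠ ∞ :=
    ne_top_of_le_ne_top ENNReal.ofReal_ne_top (ENNReal.tsum_le_of_sum_range_le hpart)
  have htail := ENNReal.tendsto_sum_nat_add _ hsum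
  have hcurve : ∀ k, μH[1] (⋃ j ∈ Finset.range k, γ j '' Set.Icc 0 (ℓ j)) ≤
      ENNReal.ofReal L := by
    intro k
    refine (measure_biUnion_finset_le _ _).trans (le_trans (Finset.sum_le_sum fun j _ => ?_)
      (hpart k))
    have h := (lipschitzOnWith_and_isCompact_image_Icc (a := ℓ j) (hγ j)).1.hausdorffMeasure_image_le
      (d := 1) zero_le_one
    simpa [hausdorffMeasure_real] using h
  have hcoe : ∀ s : Set X, μH[1] s = OuterMeasure.mkMetric (fun r => r ^ (1 : ℝ)) s := fun s => by
    rw [← Measure.mkMetric_toOuterMeasure]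
    rfl
  have hpre : ∀ (r : ℝ≥0∞) (_ : 0 < r) (s : Set X),
      OuterMeasure.mkMetric'.pre (fun s : Set X => Metric.ediam s ^ (1 : ℝ)) r s ≤ μH[1] s := by
    intro r hr s
    rw [hcoe]
    exact le_iSup₂ (f := fun (r : ℝ≥0∞) (_ : 0 < r) =>
      OuterMeasure.mkMetric'.pre (fun s : Set X => Metric.ediam s ^ (1 : ℝ)) r) r hr s
  rw [hcoe, OuterMeasure.mkMetric, OuterMeasure.mkMetric']
  simp only [OuterMeasure.iSup_apply]
  refine iSup₂_le fun r hr => ?_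
  set ν := OuterMeasure.mkMetric'.pre (fun s : Set X => Metric.ediam s ^ (1 : ℝ)) r with hν
  have h2 : Tendsto (fun k => 2 * ∑' i, ENNReal.ofReal (ℓ (i + k))) atTop (𝓝 0) := by
    simpa using ENNReal.Tendsto.const_mul htail (Or.inr (by norm_num : (2 : ℝ≥0∞) ≠ ∞))
  have h3 : Tendsto (fun k => ENNReal.ofReal L + 2 * ∑' i, ENNReal.ofReal (ℓ (i + k))) atTop
      (𝓝 (ENNReal.ofReal L)) := by
    simpa using h2.const_add (ENNReal.ofReal L)
  refine ge_of_tendsto h3 ?_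
  filter_upwards [h2.eventually_le_const hr, eventually_gt_atTop 0] with k hkr hk
  obtain ⟨e, w, hw, hcov⟩ := subset_iUnion_branch hℓ hsum hγ hatt hT hk
  calc ν T ≤ ν (⋃ j ∈ Finset.range k, γ j '' Set.Icc 0 (ℓ j)) +
        ν (⋃ r, Metric.closedEBall (e r) (w r)) := (measure_mono hcov).trans (measure_union_le _ _)
    _ ≤ ENNReal.ofReal L + ∑' i, 2 * w i := by
        refine add_le_add ((hpre r hr _).trans (hcurve k)) ?_
        refine (measure_iUnion_le _).trans (ENNReal.tsum_le_tsum fun i => ?_)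
        have hd : Metric.ediam (Metric.closedEBall (e i) (w i)) ≤ 2 * w i :=
          Metric.ediam_closedEBall_le
        refine (OuterMeasure.mkMetric'.pre_le ?_).trans ?_
        · refine hd.trans (le_trans ?_ hkr)
          rw [← hw]
          gcongr
          exact ENNReal.le_tsum i
        · rwa [ENNReal.rpow_one]
    _ = ENNReal.ofReal L + 2 * ∑' i, ENNReal.ofReal (ℓ (i + k)) := by
        rw [ENNReal.tsum_mul_left, hw]

end Tree

/-! ### Enlarging a set to a prescribed measure -/

/-- The measure of the union of a fixed set and a growing arc of a Lipschitz curve takes all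
intermediate values. -/
theorem exists_hausdorffMeasure_union_image_eq {X : Type*} [MetricSpace X] [MeasurableSpace X]
    [BorelSpace X] {S : Set X} {L : ℝ} (hL : 0 ≤ L) (hS : μH[1] S ≤ ENNReal.ofReal L)
    {K : NNReal} {γ : ℝ → X} (hγ : LipschitzWith K γ) (h0 : γ 0 ∈ S) {T : ℝ} (hT : 0 ≤ T)
    (hLT : ENNReal.ofReal L ≤ μH[1] (γ '' Set.Icc 0 T)) :
    ∃ t ∈ Set.Icc 0 T, μH[1] (S ∪ γ '' Set.Icc 0 t) = ENNReal.ofReal L := by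
  have harc : ∀ s t : ℝ, μH[1] (γ '' Set.Icc s t) ≤ K * ENNReal.ofReal (t - s) := fun s t => by
    have h := hγ.hausdorffMeasure_image_le (d := 1) zero_le_one (Set.Icc s t)
    simpa [hausdorffMeasure_real] using h
  have hfin : ∀ t, μH[1] (S ∪ γ '' Set.Icc 0 t) ≠ ∞ := fun t =>
    ne_top_of_le_ne_top (ENNReal.add_ne_top.2 ⟨ENNReal.ofReal_ne_top,
      ENNReal.mul_ne_top ENNReal.coe_ne_top ENNReal.ofReal_ne_top⟩)
      ((measure_union_le _ _).trans (add_le_add hS (harc 0 t)))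
  set f : ℝ → ℝ := fun t => (μH[1] (S ∪ γ '' Set.Icc 0 t)).toReal with hf
  have hlip : LipschitzWith K f := by
    refine LipschitzWith.of_le_add_mul K fun t s => ?_
    have h1 : μH[1] (S ∪ γ '' Set.Icc 0 t) ≤
        μH[1] (S ∪ γ '' Set.Icc 0 s) + K * ENNReal.ofReal (t - s) := by
      refine (measure_mono ?_).trans ((measure_union_le _ _).trans (add_le_add le_rfl (harc s t)))
      rintro x (hx | ⟨u, hu, rfl⟩)
      · exact Or.inl (Or.inl hx)
      · rcases le_total u s with h | h
        · exact Or.inl (Or.inr ⟨u, ⟨hu.1, h⟩, rfl⟩)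
        · exact Or.inr ⟨u, ⟨h, hu.2⟩, rfl⟩
    have hK : (K : ℝ≥0∞) * ENNReal.ofReal (t - s) ≠ ∞ :=
      ENNReal.mul_ne_top ENNReal.coe_ne_top ENNReal.ofReal_ne_top
    have h2 := ENNReal.toReal_mono (ENNReal.add_ne_top.2 ⟨hfin s, hK⟩) h1
    rw [ENNReal.toReal_add (hfin s) hK, ENNReal.toReal_mul, ENNReal.toReal_ofReal',
      ENNReal.coe_toReal] at h2
    refine h2.trans ?_
    gcongr
    rw [Real.dist_eq]
    exact max_le (le_abs_self _) (abs_nonneg _)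
  have hf0 : f 0 ≤ L := by
    refine ENNReal.toReal_le_of_le_ofReal hL ?_
    rwa [Set.Icc_self, Set.image_singleton, Set.union_eq_self_of_subset_right
      (Set.singleton_subset_iff.2 h0)]
  have hfT : L ≤ f T := (ENNReal.ofReal_le_iff_le_toReal (hfin T)).1
    (hLT.trans (measure_mono Set.subset_union_right))
  obtain ⟨t, ht, htL⟩ := intermediate_value_Icc hT hlip.continuous.continuousOn ⟨hf0, hfT⟩
  exact ⟨t, ht, by rw [← htL, ENNReal.ofReal_toReal (hfin t)]⟩

theorem norm_vec_two_le (a b : ℝ) : ‖(!₂[a, b] : Plane)‖ ≤ |a| + |b| := by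
  rw [EuclideanSpace.norm_eq, Fin.sum_univ_two]
  refine Real.sqrt_le_iff.2 ⟨by positivity, ?_⟩
  simp only [Real.norm_eq_abs]
  change |a| ^ 2 + |b| ^ 2 ≤ _
  nlinarith [mul_nonneg (abs_nonneg a) (abs_nonneg b)]

/-- Small balls of the plane contain Lipschitz curves of arbitrarily large one-dimensional measure
that start at the centre: graphs of functions with many oscillations. -/
theorem exists_lipschitz_curve_in_ball (x : Plane) {r : ℝ} (hr : 0 < r) (L : ℝ) :
    ∃ (K : NNReal) (γ : ℝ → Plane) (T : ℝ), 0 ≤ T ∧ LipschitzWith K γ ∧ γ 0 = x ∧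
      (∀ t ∈ Set.Icc 0 T, γ t ∈ Metric.ball x r) ∧
      ENNReal.ofReal L ≤ μH[1] (γ '' Set.Icc 0 T) := by
  obtain ⟨a, ha, har⟩ : ∃ a, 0 < a ∧ 3 * a < r := ⟨r / 4, by positivity, by linarith⟩
  obtain ⟨N, hN⟩ := exists_nat_gt (L / (2 * a))
  have hπ := Real.pi_pos
  -- each of the `N + 1` oscillations contributes at least `2 * a`
  set T : ℝ := 2 * Real.pi * (N + 1) with hTdef
  have hT : 0 < T := by positivity
  set γ : ℝ → Plane := fun t => x + !₂[a * (t / T), a * (Real.cos t - 1)] with hγdef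
  have hγ0 : ∀ t, γ t 0 = x 0 + a * (t / T) := fun t => rfl
  have hγ1 : ∀ t, γ t 1 = x 1 + a * (Real.cos t - 1) := fun t => rfl
  have hlip : LipschitzWith (Real.toNNReal (a / T + a)) γ := by
    refine LipschitzWith.of_dist_le_mul fun s t => ?_
    rw [Real.coe_toNNReal _ (by positivity), dist_eq_norm]
    have h1 : γ s - γ t = !₂[a * (s / T) - a * (t / T),
        a * (Real.cos s - 1) - a * (Real.cos t - 1)] := by
      ext i
      fin_cases i
      · simp [hγdef]
      · simp [hγdef]
    rw [h1]
    refine (norm_vec_two_le _ _).trans ?_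
    have h2 : a * (s / T) - a * (t / T) = a / T * (s - t) := by ring
    have h3 : a * (Real.cos s - 1) - a * (Real.cos t - 1) = a * (Real.cos s - Real.cos t) := by ring
    rw [h2, h3, abs_mul, abs_mul, abs_of_pos ha, abs_of_pos (by positivity : 0 < a / T), add_mul,
      Real.dist_eq]
    exact add_le_add le_rfl (mul_le_mul_of_nonneg_left (Real.abs_cos_sub_cos_le s t) ha.le)
  refine ⟨_, γ, T, hT.le, hlip, ?_, fun t ht => ?_, ?_⟩
  · ext i
    fin_cases i
    · simp [hγdef]
    · simp [hγdef]
  · rw [Metric.mem_ball, dist_eq_norm, hγdef, add_sub_cancel_left]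
    refine (norm_vec_two_le _ _).trans_lt ?_
    have h1 : t / T ≤ 1 := (div_le_one hT).2 ht.2
    have h2 : 0 ≤ t / T := div_nonneg ht.1 hT.le
    have h3 : |Real.cos t - 1| ≤ 2 := by
      rw [abs_le]
      constructor <;> linarith [Real.neg_one_le_cos t, Real.cos_le_one t]
    rw [abs_mul, abs_mul, abs_of_pos ha, abs_of_nonneg h2]
    nlinarith
  · let J : ℕ → Set ℝ := fun k => Set.Icc (k * (2 * Real.pi)) (k * (2 * Real.pi) + Real.pi)
    have hJ : ∀ k ∈ Finset.range (N + 1), J k ⊆ Set.Icc 0 T := by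
      intro k hk t ht
      have hk' : (k : ℝ) ≤ N := by exact_mod_cast Nat.lt_succ_iff.1 (Finset.mem_range.1 hk)
      have hk0 : (0 : ℝ) ≤ k := Nat.cast_nonneg k
      refine ⟨le_trans (by positivity) ht.1, ht.2.trans ?_⟩
      rw [hTdef]
      nlinarith
    have hinj : Function.Injective γ := by
      intro s t hst
      have h1 : γ s 0 = γ t 0 := by rw [hst]
      rw [hγ0, hγ0] at h1
      have h2 : s / T = t / T := mul_left_cancel₀ ha.ne' (add_left_cancel h1)
      field_simp at h2
      exact h2
    have hdisj : Set.PairwiseDisjoint (Finset.range (N + 1) : Set ℕ) fun k => γ '' J k := by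
      have hlt : ∀ i j : ℕ, i < j → Disjoint (γ '' J i) (γ '' J j) := by
        intro i j hij
        refine (Set.disjoint_image_iff hinj).2 (Set.disjoint_left.2 fun t hi hj => ?_)
        have hij' : (i : ℝ) + 1 ≤ j := by exact_mod_cast hij
        have h1 := hi.2
        have h2 := hj.1
        nlinarith
      intro i _ j _ hij
      rcases lt_or_gt_of_ne hij with h | h
      · exact hlt i j h
      · exact (hlt j i h).symm
    have hmeas : ∀ k ∈ Finset.range (N + 1), MeasurableSet (γ '' J k) := fun k _ =>
      (isCompact_Icc.image hlip.continuous).isClosed.measurableSet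
    have hpiece : ∀ k : ℕ, ENNReal.ofReal (2 * a) ≤ μH[1] (γ '' J k) := by
      intro k
      have hproj : LipschitzWith 1 fun z : Plane => z 1 :=
        LipschitzWith.of_dist_le_mul fun z z' => by
          rw [NNReal.coe_one, one_mul, dist_eq_norm, dist_eq_norm]
          exact PiLp.norm_apply_le (z - z') 1
      have hsub : Set.Icc (x 1 - 2 * a) (x 1) ⊆ (fun z : Plane => z 1) '' (γ '' J k) := by
        rw [Set.image_image]
        have h1 := intermediate_value_Icc' (f := fun t => γ t 1)
          (show (k : ℝ) * (2 * Real.pi) ≤ k * (2 * Real.pi) + Real.pi by linarith)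
          (hproj.continuous.comp hlip.continuous).continuousOn
        refine subset_trans (Set.Icc_subset_Icc ?_ ?_) h1
        · simp only [hγ1, Real.cos_nat_mul_two_pi_add_pi]
          linarith
        · simp only [hγ1, Real.cos_nat_mul_two_pi]
          linarith
      calc ENNReal.ofReal (2 * a) = volume (Set.Icc (x 1 - 2 * a) (x 1)) := by
            rw [Real.volume_Icc]; congr 1; ring
        _ = μH[1] (Set.Icc (x 1 - 2 * a) (x 1)) := by rw [hausdorffMeasure_real]
        _ ≤ μH[1] ((fun z : Plane => z 1) '' (γ '' J k)) := measure_mono hsub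
        _ ≤ μH[1] (γ '' J k) := by
            simpa using hproj.hausdorffMeasure_image_le (d := 1) zero_le_one (γ '' J k)
    calc ENNReal.ofReal L ≤ ENNReal.ofReal ((N + 1 : ℕ) * (2 * a)) := by
          refine ENNReal.ofReal_le_ofReal ?_
          rw [div_lt_iff₀ (by positivity)] at hN
          push_cast
          nlinarith
      _ = ∑ _k ∈ Finset.range (N + 1), ENNReal.ofReal (2 * a) := by
          rw [Finset.sum_const, Finset.card_range, nsmul_eq_mul, ENNReal.ofReal_mul (by positivity),
            ENNReal.ofReal_natCast]
      _ ≤ ∑ k ∈ Finset.range (N + 1), μH[1] (γ '' J k) := Finset.sum_le_sum fun k _ => hpiece k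
      _ = μH[1] (⋃ k ∈ Finset.range (N + 1), γ '' J k) :=
          (measure_biUnion_finset hdisj hmeas).symm
      _ ≤ μH[1] (γ '' Set.Icc 0 T) := measure_mono (Set.iUnion₂_subset fun k hk =>
          Set.image_mono (hJ k hk))

/-! ### Gołąb's theorem -/

theorem isPreconnected_iUnion_of_tree {X : Type*} [MetricSpace X] {ℓ : ℕ → ℝ} {γ : ℕ → ℝ → X}
    (hℓ : ∀ j, 0 ≤ ℓ j) (hγ : ∀ j s t, 0 ≤ s → s ≤ t → dist (γ j s) (γ j t) ≤ t - s)
    (hatt : ∀ j, 0 < j → ∃ i < j, ∃ t ∈ Set.Icc 0 (ℓ i), γ j (ℓ j) = γ i t) :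
    IsPreconnected (⋃ j, γ j '' Set.Icc 0 (ℓ j)) := by
  have hcurve : ∀ j, IsPreconnected (γ j '' Set.Icc 0 (ℓ j)) := fun j =>
    isPreconnected_Icc.image _ (lipschitzOnWith_and_isCompact_image_Icc (hγ j)).1.continuousOn
  have hpart : ∀ k : ℕ, IsPreconnected (⋃ j ∈ Set.Iic k, γ j '' Set.Icc 0 (ℓ j)) := by
    intro k
    induction k with
    | zero => simpa using hcurve 0
    | succ k ih =>
      obtain ⟨i, hi, t, ht, h⟩ := hatt (k + 1) (Nat.succ_pos k)
      have hset : (⋃ j ∈ Set.Iic (k + 1), γ j '' Set.Icc 0 (ℓ j)) =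
          (⋃ j ∈ Set.Iic k, γ j '' Set.Icc 0 (ℓ j)) ∪
            γ (k + 1) '' Set.Icc 0 (ℓ (k + 1)) := by
        rw [← Order.succ_eq_add_one, Order.Iic_succ, Set.biUnion_insert, Set.union_comm]
      rw [hset]
      exact ih.union (γ i t) (Set.mem_biUnion (x := i) (Nat.lt_succ_iff.1 hi) ⟨t, ht, rfl⟩)
        ⟨ℓ (k + 1), ⟨hℓ _, le_rfl⟩, h⟩ (hcurve _)
  have heq : (⋃ j, γ j '' Set.Icc 0 (ℓ j)) = ⋃ k, ⋃ j ∈ Set.Iic k, γ j '' Set.Icc 0 (ℓ j) := by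
    refine Set.Subset.antisymm (Set.iUnion_subset fun j => ?_)
      (Set.iUnion_subset fun k => Set.iUnion₂_subset fun j _ =>
        Set.subset_iUnion (fun j => γ j '' Set.Icc 0 (ℓ j)) j)
    exact Set.subset_iUnion_of_subset j
      (Set.subset_biUnion_of_mem (u := fun j => γ j '' Set.Icc 0 (ℓ j)) Set.self_mem_Iic)
  rw [heq]
  refine isPreconnected_iUnion ⟨γ 0 0, Set.mem_iInter.2 fun k => ?_⟩ hpart
  exact Set.mem_biUnion (x := 0) (Nat.zero_le k) ⟨0, ⟨le_rfl, hℓ 0⟩, rfl⟩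

/-- **Gołąb's theorem**: a Hausdorff limit of connected sets of one-dimensional measure at most `L`
in a compact set is connected and has measure at most `L`. -/
theorem isConnected_and_hausdorffMeasure_le_of_tendsto {X : Type*} [MetricSpace X]
    [MeasurableSpace X] [BorelSpace X] {S : ℕ → Set X} {T C : Set X} {L : ℝ} (hL : 0 ≤ L)
    (hS : ∀ n, IsConnected (S n)) (hSL : ∀ n, μH[1] (S n) ≤ ENNReal.ofReal L) (hC : IsCompact C)
    (hSC : ∀ n, S n ⊆ C) (hT : IsCompact T) (hT0 : T.Nonempty) (hTC : T ⊆ C)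
    (hTS : Tendsto (fun n => Metric.hausdorffEDist (S n) T) atTop (𝓝 0)) :
    IsConnected T ∧ μH[1] T ≤ ENNReal.ofReal L := by
  have : CompactSpace T := isCompact_iff_compactSpace.1 hT
  have : Nonempty T := hT0.to_subtype
  obtain ⟨ℓ, γ, hℓ, hsum, hγ0, hγT, hγ, hatt⟩ := exists_lipschitz_tree hL hS hSL hC hSC
    hT.isClosed hTC hTS (p := fun j => (denseSeq T j : X)) fun j => (denseSeq T j).2
  have hdense : T ⊆ closure (Set.range fun j => γ j 0) := by
    intro x hx
    have h := image_closure_subset_closure_image (s := Set.range (denseSeq T))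
      (continuous_subtype_val (p := fun x => x ∈ T))
      ⟨⟨x, hx⟩, denseRange_denseSeq T ⟨x, hx⟩, rfl⟩
    rw [← Set.range_comp] at h
    simp only [hγ0]
    exact h
  refine ⟨⟨hT0, (isPreconnected_iUnion_of_tree hℓ hγ hatt).subset_closure
    (Set.iUnion_subset fun j => ?_) (hdense.trans (closure_mono ?_))⟩,
    hausdorffMeasure_le_of_tree hℓ hsum hγ hatt hdense⟩
  · rintro _ ⟨s, -, rfl⟩
    exact hγT j s
  · rintro _ ⟨j, rfl⟩
    exact Set.mem_iUnion.2 ⟨j, 0, ⟨le_rfl, hℓ j⟩, rfl⟩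

/-! ### Admissible sets and existence of a minimizer -/

/-- A competitor of too small measure can be enlarged to an admissible one if it meets `Ω`. Points
of the boundary of `Ω` would not do, as they need not be accessible by rectifiable curves. -/
theorem exists_mem_admissibleSets_superset {Ω : Opens Plane} {L : ℝ} (hL : 0 ≤ L) {S : Set Plane}
    (hS : IsCompact S) (hSc : IsConnected S) (hSΩ : S ⊆ closure (Ω : Set Plane))
    (hSL : μH[1] S ≤ ENNReal.ofReal L) {x : Plane} (hxS : x ∈ S) (hxΩ : x ∈ Ω) :
    ∃ K ∈ admissibleSets Ω L, S ⊆ (K : Set Plane) := by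
  obtain ⟨r, hr, hball⟩ := Metric.isOpen_iff.1 Ω.isOpen x hxΩ
  obtain ⟨K, γ, T, hT, hγ, hγ0, hγball, hγL⟩ := exists_lipschitz_curve_in_ball x hr L
  have h0 : γ 0 ∈ S := hγ0 ▸ hxS
  obtain ⟨t, ht, htL⟩ := exists_hausdorffMeasure_union_image_eq hL hSL hγ h0 hT hγL
  refine ⟨⟨S ∪ γ '' Set.Icc 0 t, hS.isClosed.union
    (isCompact_Icc.image hγ.continuous).isClosed⟩, ⟨?_, ?_, htL⟩, Set.subset_union_left⟩
  · refine Set.union_subset hSΩ ?_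
    rintro _ ⟨s, hs, rfl⟩
    exact subset_closure (hball (hγball s ⟨hs.1, hs.2.trans ht.2⟩))
  · exact hSc.union ⟨γ 0, h0, 0, ⟨le_rfl, ht.1⟩, rfl⟩
      ((isConnected_Icc ht.1).image _ hγ.continuous.continuousOn)

theorem closureDiff_removeClosed (Ω : Opens Plane) {K : Closeds Plane}
    (hK : (K : Set Plane) ⊆ closure (Ω : Set Plane)) :
    closureDiff Ω (removeClosed Ω K) = (closure (Ω : Set Plane) \ Ω) ∪ K := by
  ext x
  have h1 : x ∈ closureDiff Ω (removeClosed Ω K) ↔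
      x ∈ closure (Ω : Set Plane) ∧ ¬ (x ∈ (Ω : Set Plane) ∧ x ∉ (K : Set Plane)) := Iff.rfl
  have h2 := @hK x
  rw [h1, Set.mem_union, Set.mem_sdiff]
  tauto

theorem removeClosed_mono {Ω : Opens Plane} {K K' : Closeds Plane}
    (h : (Ω : Set Plane) ∩ K ⊆ K') : removeClosed Ω K' ≤ removeClosed Ω K := by
  have h' : ((Ω : Set Plane) \ K' : Set Plane) ⊆ (Ω : Set Plane) \ K :=
    fun x hx => ⟨hx.1, fun hxK => hx.2 (h ⟨hx.1, hxK⟩)⟩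
  exact h'

theorem theorem1p1 (Ω : Opens Plane) (hΩc : IsConnected (Ω : Set Plane))
    (hΩb : Bornology.IsBounded (Ω : Set Plane)) (L : ℝ) (hL : 0 < L)
    (F : OpenSubsets Ω → ℝ≥0∞) (hF_lsc : HausdorffLowerSemicontinuous Ω F)
    (hF_mono : Monotone F) :
    ∃ K ∈ admissibleSets Ω L,
      IsMinOn (fun K : Closeds Plane => F (removeClosed Ω K)) (admissibleSets Ω L) K := by
  have hC : IsCompact (closure (Ω : Set Plane)) := hΩb.isCompact_closure
  obtain ⟨x₀, hx₀⟩ := hΩc.nonempty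
  have := Measure.nullSingletonClass_hausdorff Plane (zero_lt_one (α := ℝ))
  obtain ⟨K₀, hK₀, -⟩ := exists_mem_admissibleSets_superset hL.le isCompact_singleton
    isConnected_singleton (Set.singleton_subset_iff.2 (subset_closure hx₀))
    ((measure_singleton x₀).trans_le zero_le) (Set.mem_singleton x₀) hx₀
  obtain ⟨u, -, hu, hmem⟩ := exists_seq_tendsto_sInf
    (Set.Nonempty.image (fun K : Closeds Plane => F (removeClosed Ω K)) ⟨K₀, hK₀⟩)
    (OrderBot.bddBelow _)
  choose K hK hKu using hmem
  let Q : ℕ → NonemptyCompacts Plane := fun n =>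
    ⟨⟨K n, hC.of_isClosed_subset (K n).isClosed (hK n).1⟩, (hK n).2.1.nonempty⟩
  obtain ⟨S, hSC, φ, hφ, hlim⟩ :=
    (NonemptyCompacts.isCompact_subsets_of_isCompact hC).tendsto_subseq (x := Q) fun n => (hK n).1
  have hHaus : Tendsto (fun n => Metric.hausdorffEDist (K (φ n) : Set Plane) (S : Set Plane))
      atTop (𝓝 0) := tendsto_iff_edist_tendsto_0.1 hlim
  obtain ⟨hSconn, hSL⟩ := isConnected_and_hausdorffMeasure_le_of_tendsto hL.le
    (fun n => (hK (φ n)).2.1) (fun n => (hK (φ n)).2.2.le) hC (fun n => (hK (φ n)).1)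
    S.isCompact S.nonempty hSC hHaus
  let S' : Closeds Plane := ⟨S, S.isCompact.isClosed⟩
  have hlow : F (removeClosed Ω S') ≤
      sInf ((fun K : Closeds Plane => F (removeClosed Ω K)) '' admissibleSets Ω L) := by
    refine (hF_lsc (fun n => removeClosed Ω (K (φ n))) _ ?_).trans (le_of_eq ?_)
    · refine tendsto_of_tendsto_of_tendsto_of_le_of_le tendsto_const_nhds hHaus
        (fun n => zero_le) fun n => ?_
      rw [closureDiff_removeClosed Ω (hK (φ n)).1, closureDiff_removeClosed Ω (K := S') hSC]
      refine Metric.hausdorffEDist_union_le.trans ?_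
      rw [Metric.hausdorffEDist_self, max_eq_right zero_le]
      exact le_rfl
    · have h : (fun n => F (removeClosed Ω (K (φ n)))) = u ∘ φ := funext fun n => hKu (φ n)
      rw [h]
      exact (hu.comp hφ.tendsto_atTop).liminf_eq
  obtain ⟨K₁, hK₁, hle⟩ : ∃ K₁ ∈ admissibleSets Ω L, (Ω : Set Plane) ∩ S' ⊆ K₁ := by
    by_cases hmeet : ∃ x ∈ (S : Set Plane), x ∈ Ω
    · obtain ⟨x, hxS, hxΩ⟩ := hmeet
      obtain ⟨K₁, hK₁, hsub⟩ := exists_mem_admissibleSets_superset hL.le S.isCompact hSconn hSC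
        hSL hxS hxΩ
      exact ⟨K₁, hK₁, Set.inter_subset_right.trans hsub⟩
    -- a limit contained in the boundary removes nothing, so it is beaten by any admissible set
    · exact ⟨K₀, hK₀, fun x hx => absurd ⟨x, hx.2, hx.1⟩ hmeet⟩
  refine ⟨K₁, hK₁, fun K' hK' => ?_⟩
  exact (hF_mono (removeClosed_mono hle)).trans (hlow.trans (sInf_le ⟨K', hK', rfl⟩))
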